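/- Let $V$ be a Euclidean vector space and $\Phi\subset V^*$ an irreducible reduced crystallographic root system on $V$ of classical type, i.e. $\Phi$ is isomorphic to a root system of type $A_n$ ($n\ge 1$), $B_n$ ($n\ge 3$), $C_n$ ($n\ge 2$) or $D_n$ ($n\ge 4$). Let $E$ be a Euclidean affine space with vector space $V$ and a reference point $p\in E$, and let $\mathcal{A}$ be the affine apartment of split type $\Phi$ on $E$: its affine roots are the closed half-spaces $\{x\in E : a(x-p)+k\ge 0\}$ with $a\in\Phi$, $k\in\mathbb{Z}$, and its walls are their boundary hyperplanes. The facets of $\mathcal{A}$ are the cells into which the walls decompose $E$, the vertices are the points that form a facet by themselves, and two vertices are adjacent if the open segment joining them is a facet. A point of $E$ is special if every wall is parallel to a wall through it; such a point is a vertex. For vertices $x,y$, let $d(x,y)$ be the simplicial distance, that is, the minimal length $l$ of a sequence of vertices $x=x_0,x_1,\dots,x_l=y$ in which consecutive ones are adjacent. **Theorem.** Let $o$ be a special vertex of $\mathcal{A}$, let $\Delta$ be a basis of $\Phi$ with Weyl chamber $C=\{v\in V : a(v)>0 \text{ for all } a\in\Delta\}$, and let $a_0$ be the highest root of $\Phi$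 relative to $\Delta$. Then for every vertex $x$ in the closed cone $\overline{o+C}$ and every integer $r\ge 0$, $$d(x,o)\le r \iff a_0(x-o)\le r .$$ -/

import Mathlib

/-! ### The irreducible root systems of classical type, in coordinates -/

namespace ClassicalRoots

open Module

/-- The `i`-th coordinate function `χ i` on `ℝ ^ n`. -/
def χ {n : ℕ} (i : Fin n) : Dual ℝ (Fin n → ℝ) := LinearMap.proj i

/-- The hyperplane of `ℝ ^ (n + 1)` consisting of the vectors whose coordinates sum to zero. -/
def sumZero (n : ℕ) : Submodule ℝ (Fin (n + 1) → ℝ) := LinearMap.ker (∑ i, χ i)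

/-- The roots of type `A n`: the functions `χ i - χ j`, `i ≠ j`, on the sum-zero hyperplane of
`ℝ ^ (n + 1)`. -/
def rootsA (n : ℕ) : Set (Dual ℝ (sumZero n)) :=
  {f | ∃ i j, i ≠ j ∧ f = (χ i - χ j) ∘ₗ (sumZero n).subtype}

/-- The roots of type `D n`: the functions `± χ i ± χ j`, `i < j`, on `ℝ ^ n`. -/
def rootsD (n : ℕ) : Set (Dual ℝ (Fin n → ℝ)) :=
  {f | ∃ i j, i < j ∧ ∃ s ∈ ({1, -1} : Set ℝ), ∃ t ∈ ({1, -1} : Set ℝ), f = s • χ i + t • χ j}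

/-- The roots of type `B n`: the functions `± χ i ± χ j`, `i < j`, and `± χ i` on `ℝ ^ n`. -/
def rootsB (n : ℕ) : Set (Dual ℝ (Fin n → ℝ)) :=
  rootsD n ∪ {f | ∃ i, ∃ s ∈ ({1, -1} : Set ℝ), f = s • χ i}

/-- The roots of type `C n`: the functions `± χ i ± χ j`, `i < j`, and `± 2 χ i` on `ℝ ^ n`. -/
def rootsC (n : ℕ) : Set (Dual ℝ (Fin n → ℝ)) :=
  rootsD n ∪ {f | ∃ i, ∃ s ∈ ({1, -1} : Set ℝ), f = (2 * s) • χ i}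

end ClassicalRoots

namespace SplitApartment

open Module ClassicalRoots

section RootSystem

variable {ι M V : Type*} [AddCommGroup M] [Module ℝ M] [AddCommGroup V] [Module ℝ V]

/-- The roots of `P`, seen as linear functions on `V`, are carried to the set `Φ₀` of linear
functions on `V₀` by some linear isomorphism from `V` to `V₀`. -/
def IsIsomorphicTo (P : RootPairing ι ℝ M V) {V₀ : Type*} [AddCommGroup V₀] [Module ℝ V₀]
    (Φ₀ : Set (Dual ℝ V₀)) : Prop :=
  ∃ e : V ≃ₗ[ℝ] V₀, Set.range P.root' = (fun f : Dual ℝ V₀ => f ∘ₗ e.toLinearMap) '' Φ₀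

/-- `P` is of one of the types `A n` (`n ≥ 1`), `B n` (`n ≥ 3`), `C n` (`n ≥ 2`),
`D n` (`n ≥ 4`). -/
def IsClassical (P : RootPairing ι ℝ M V) : Prop :=
  (∃ n, 1 ≤ n ∧ IsIsomorphicTo P (rootsA n)) ∨
  (∃ n, 3 ≤ n ∧ IsIsomorphicTo P (rootsB n)) ∨
  (∃ n, 2 ≤ n ∧ IsIsomorphicTo P (rootsC n)) ∨
  (∃ n, 4 ≤ n ∧ IsIsomorphicTo P (rootsD n))

/-- The (open) Weyl chamber of a basis: the vectors on which all simple roots are positive. -/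
def weylChamber {P : RootPairing ι ℝ M V} (b : P.Base) : Set V :=
  {v | ∀ i ∈ b.support, 0 < P.root' i v}

/-- The root with index `i₀` is the highest root relative to the basis `b`: for every root `a`, each
coefficient of `a` with respect to the simple roots is at most that of the root `i₀`, that is, the
difference is a combination of simple roots with natural coefficients. -/
def IsHighestRoot {P : RootPairing ι ℝ M V} (b : P.Base) (i₀ : ι) : Prop :=
  ∀ i, P.root i₀ - P.root i ∈ AddSubmonoid.closure (P.root '' b.support)

end RootSystem

section Apartment

variable {ι M V E : Type*} [AddCommGroup M] [Module ℝ M] [NormedAddCommGroup V]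
  [InnerProductSpace ℝ V] [MetricSpace E] [NormedAddTorsor V E]

/-- The reflections of the root system are orthogonal for the inner product of `V`. -/
def ReflectionsOrthogonal (P : RootPairing ι ℝ M V) : Prop :=
  ∀ i v w, inner ℝ (P.coreflection i v) (P.coreflection i w) = inner ℝ v w

/-- The affine root `a + k`, for `a` the root with index `i` and an integer `k`, of the apartment of
split type `P` on the Euclidean affine space `E` with reference point `p`: the closed half-space
`{x | 0 ≤ a (x - p) + k}`. -/
def affineRoot (P : RootPairing ι ℝ M V) (p : E) (i : ι) (k : ℤ) : Set E :=
  {x | 0 ≤ P.root' i (x -ᵥ p) + k}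

/-- The wall bounding the affine root `a + k`. -/
def wall (P : RootPairing ι ℝ M V) (p : E) (i : ι) (k : ℤ) : Set E :=
  {x | P.root' i (x -ᵥ p) + k = 0}

/-- The facet containing `x`: the points that lie in the same affine roots as `x`. As the half-space
opposite to an affine root is an affine root, these are the points that, for each wall, lie on it
when `x` does, and strictly on the same side of it as `x` otherwise. -/
def facet (P : RootPairing ι ℝ M V) (p : E) (x : E) : Set E :=
  {y | ∀ i k, y ∈ affineRoot P p i k ↔ x ∈ affineRoot P p i k}

/-- The facets, i.e. the cells into which the walls decompose `E`. -/
def IsFacet (P : RootPairing ι ℝ M V) (p : E) (F : Set E) : Prop :=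
  ∃ x, F = facet P p x

/-- A vertex is a point that is a facet by itself. -/
def IsVertex (P : RootPairing ι ℝ M V) (p : E) (x : E) : Prop :=
  IsFacet P p {x}

/-- A point is special if every wall is parallel to a wall through it; equivalently, every root is
the vectorial part of an affine root whose wall contains the point. -/
def IsSpecial (P : RootPairing ι ℝ M V) (p : E) (x : E) : Prop :=
  ∀ i, ∃ k : ℤ, x ∈ wall P p i k

/-- The type of vertices of the apartment. -/
abbrev Vertex (P : RootPairing ι ℝ M V) (p : E) : Type _ := {x : E // IsVertex P p x}

/-- The graph of vertices and edges of the apartment: two vertices are adjacent if the open segment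
between them is a facet. -/
def vertexGraph (P : RootPairing ι ℝ M V) (p : E) : SimpleGraph (Vertex P p) where
  Adj x y := IsFacet P p {z | Sbtw ℝ (x : E) z (y : E)}
  symm := ⟨fun x y h => by simpa only [sbtw_comm] using h⟩
  loopless := ⟨fun x ⟨z, hz⟩ => by
    have h : z ∈ facet P p z := fun _ _ => Iff.rfl
    rw [← hz] at h
    simp at h⟩

/-- The simplicial distance of two vertices: the minimal length of a path of adjacent vertices from
one to the other (and `⊤` if there is no path). -/
noncomputable def simplicialDist (P : RootPairing ι ℝ M V) (p : E) (x y : Vertex P p) : ℕ∞ :=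
  (vertexGraph P p).edist x y

/-- The closed cone: the closure of `o + C`, for `C` the Weyl chamber of the basis `b`. -/
def closedCone {P : RootPairing ι ℝ M V} (b : P.Base) (o : E) : Set E :=
  closure ((fun v : V => v +ᵥ o) '' weylChamber b)

end Apartment

end SplitApartment

/-! On the closed cone the highest root dominates every root, so the bound on `a₀` amounts to `a (x
- o) ≤ r` for all roots `a`. In that form the cone is no longer needed: for any vertex `x`, the
distance to `o` is at most `r` iff all roots are at most `r` at `x - o`.

Since `o` is special, the walls are the level sets of the roots at integers when vectors are
measured from `o`. An open edge is a facet, so no root crosses an integer inside it and each root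
changes by at most one per step; this gives the lower bound on the distance
(`root'_le_of_simplicialDist_le`).

The upper bound is by induction on `r`, with `HasDescent` as the inductive step
(`simplicialDist_le_of_forall_root'_le`). Descent concerns only a set of linear functionals, so it
passes through a linear isomorphism to the coordinate models.

There an explicit move works. In type A, lower all non-minimal coordinates by one. In type C, shrink
by `1/2` the coordinates of largest permitted absolute value. In types B and D, shrink by `1/2` all
coordinates in one suitable class modulo 1, except that a lone coordinate `±(r + 1)` moves by a
whole unit. -/

namespace SplitApartment

open Module

/-! ### Vertices, edges and descent for a set of linear functionals -/

section Functionals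

variable {V V₀ : Type*} [AddCommGroup V] [Module ℝ V] [AddCommGroup V₀] [Module ℝ V₀]

/-- The hyperplanes `f = k`, `f ∈ Φ`, `k ∈ ℤ`, through `x` meet in the point `x` only. -/
def IsIsolated (Φ : Set (Dual ℝ V)) (x : V) : Prop :=
  ∀ w, (∀ f ∈ Φ, (∃ k : ℤ, f x = k) → f w = 0) → w = 0

/-- No hyperplane `f = k`, `f ∈ Φ`, `k ∈ ℤ`, separates `x` and `y` strictly, and those through both
points meet in the line through them. -/
structure IsEdge (Φ : Set (Dual ℝ V)) (x y : V) : Prop where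
  ne : x ≠ y
  not_separated : ∀ f ∈ Φ, ∃ k : ℤ, (k ≤ f x ∧ f x ≤ k + 1) ∧ (k ≤ f y ∧ f y ≤ k + 1)
  line : ∀ w, (∀ f ∈ Φ, (∃ k : ℤ, f x = k ∧ f y = k) → f w = 0) → ∃ t : ℝ, w = t • (y - x)

/-- Every vertex on which all functionals in `Φ` are at most `r + 1` is equal or adjacent to a
vertex on which they are at most `r`. -/
def HasDescent (Φ : Set (Dual ℝ V)) : Prop :=
  ∀ (r : ℕ) (x : V), IsIsolated Φ x → (∀ f ∈ Φ, f x ≤ r + 1) →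
    ∃ y, IsIsolated Φ y ∧ (y = x ∨ IsEdge Φ x y) ∧ ∀ f ∈ Φ, f y ≤ r

theorem isIsolated_image_iff (e : V ≃ₗ[ℝ] V₀) (Φ₀ : Set (Dual ℝ V₀)) (x : V) :
    IsIsolated ((fun f : Dual ℝ V₀ => f ∘ₗ e.toLinearMap) '' Φ₀) x ↔ IsIsolated Φ₀ (e x) := by
  constructor
  · intro h w hw
    have := h (e.symm w) (by
      rintro _ ⟨f, hf, rfl⟩ hk
      simpa using hw f hf (by simpa using hk))
    simpa using this
  · intro h w hw
    have := h (e w) (fun f hf hk => by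
      simpa using hw _ ⟨f, hf, rfl⟩ (by simpa using hk))
    simpa using this

theorem IsEdge.image {e : V ≃ₗ[ℝ] V₀} {Φ₀ : Set (Dual ℝ V₀)} {x : V} {y : V₀}
    (h : IsEdge Φ₀ (e x) y) :
    IsEdge ((fun f : Dual ℝ V₀ => f ∘ₗ e.toLinearMap) '' Φ₀) x (e.symm y) where
  ne hxy := h.ne (by simp [hxy])
  not_separated := by
    rintro _ ⟨f, hf, rfl⟩
    simpa using h.not_separated f hf
  line w hw := by
    obtain ⟨t, ht⟩ := h.line (e w) (fun f hf hk => by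
      simpa using hw _ ⟨f, hf, rfl⟩ (by simpa using hk))
    refine ⟨t, e.injective ?_⟩
    simpa using ht

theorem HasDescent.image (e : V ≃ₗ[ℝ] V₀) {Φ₀ : Set (Dual ℝ V₀)} (h : HasDescent Φ₀) :
    HasDescent ((fun f : Dual ℝ V₀ => f ∘ₗ e.toLinearMap) '' Φ₀) := by
  intro r x hx hr
  obtain ⟨y, hy, hxy, hyr⟩ := h r (e x) ((isIsolated_image_iff e Φ₀ x).1 hx)
    (fun f hf => hr _ ⟨f, hf, rfl⟩)
  refine ⟨e.symm y, (isIsolated_image_iff e Φ₀ _).2 (by simpa using hy), ?_, ?_⟩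
  · rcases hxy with rfl | hxy
    · simp
    · exact Or.inr hxy.image
  · rintro _ ⟨f, hf, rfl⟩
    simpa using hyr f hf

end Functionals

/-! ### From the apartment to integral levels of roots -/

section Apartment

variable {ι M V E : Type*} [AddCommGroup M] [Module ℝ M] [NormedAddCommGroup V]
  [InnerProductSpace ℝ V] [MetricSpace E] [NormedAddTorsor V E]
  {P : RootPairing ι ℝ M V} {p o : E}

/-- Facets record only lower bounds on roots; the opposite root supplies the upper bounds. -/
theorem exists_root'_eq_neg (P : RootPairing ι ℝ M V) (i : ι) : ∃ j, P.root' j = -P.root' i :=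
  ⟨P.reflectionPerm i i, by ext v; simp [RootPairing.root', RootPairing.root_reflectionPerm]⟩

/-- Every root is an integer at `o - p`, so replacing the origin `p` by `o` merely shifts the
integers that index the walls. -/
theorem mem_facet_iff_of_isSpecial (ho : IsSpecial P p o) {x y : E} :
    y ∈ facet P p x ↔
      ∀ i, ∀ k : ℤ, (k : ℝ) ≤ P.root' i (y -ᵥ o) ↔ (k : ℝ) ≤ P.root' i (x -ᵥ o) := by
  have key : ∀ i, ∃ c : ℤ, ∀ z : E, P.root' i (z -ᵥ p) = P.root' i (z -ᵥ o) + c := by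
    intro i
    obtain ⟨k, hk⟩ := ho i
    refine ⟨-k, fun z => ?_⟩
    rw [← vsub_add_vsub_cancel z o p, map_add]
    simp only [wall, Set.mem_ofPred_eq] at hk
    push_cast
    linarith
  constructor
  · intro h i k
    obtain ⟨c, hc⟩ := key i
    have := h i (-c - k)
    simp only [affineRoot, Set.mem_ofPred_eq, hc] at this
    push_cast at this
    constructor <;> intro h' <;> [have := this.1 (by linarith); have := this.2 (by linarith)] <;>
      linarith
  · intro h i k
    obtain ⟨c, hc⟩ := key i
    have := h i (-c - k)
    simp only [affineRoot, Set.mem_ofPred_eq, hc]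
    push_cast at this
    constructor <;> intro h' <;> [have := this.1 (by linarith); have := this.2 (by linarith)] <;>
      linarith

theorem isVertex_iff_facet_eq {x : E} : IsVertex P p x ↔ facet P p x = {x} := by
  constructor
  · rintro ⟨z, hz⟩
    have hx : x ∈ facet P p z := hz ▸ Set.mem_singleton x
    rw [hz]
    ext y
    exact forall₂_congr fun i k => by rw [hx i k]
  · exact fun h => ⟨x, h.symm⟩

/-- Points of the same facet take the same value under a root that is integral at one of them. -/
theorem root'_eq_of_mem_facet (ho : IsSpecial P p o) {x y : E} (h : y ∈ facet P p x) {i : ι}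
    {k : ℤ} (hk : P.root' i (x -ᵥ o) = k) : P.root' i (y -ᵥ o) = k := by
  rw [mem_facet_iff_of_isSpecial ho] at h
  obtain ⟨j, hj⟩ := exists_root'_eq_neg P i
  have h1 := (h i k).2 hk.ge
  have h2 := (h j (-k)).2 (by simp [hj, hk])
  simp only [hj, LinearMap.neg_apply] at h2
  push_cast at h2
  linarith

theorem isVertex_of_isIsolated (ho : IsSpecial P p o) {x : E}
    (h : IsIsolated (Set.range P.root') (x -ᵥ o)) : IsVertex P p x := by
  rw [isVertex_iff_facet_eq]
  refine Set.eq_singleton_iff_unique_mem.2 ⟨fun _ _ => Iff.rfl, fun y hy => ?_⟩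
  rw [← vsub_eq_zero_iff_eq (G := V)]
  apply h
  rintro _ ⟨i, rfl⟩ ⟨k, hk⟩
  rw [← vsub_sub_vsub_cancel_right y x o, map_sub, hk, root'_eq_of_mem_facet ho hy hk, sub_self]

/-- Were there a nonzero `w` killed by all roots integral at `x`, a small move along `w` would fix
those roots and keep the others, finitely many, strictly between the same integers. It would thus
stay in the facet `{x}`. -/
theorem isIsolated_of_isVertex [Finite ι] (ho : IsSpecial P p o) {x : E} (h : IsVertex P p x) :
    IsIsolated (Set.range P.root') (x -ᵥ o) := by
  intro w hw
  rw [isVertex_iff_facet_eq] at h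
  have ev : ∀ᶠ t : ℝ in nhds 0, ∀ i, ∀ k : ℤ, (k : ℝ) ≤ P.root' i (x -ᵥ o) + t * P.root' i w ↔
      (k : ℝ) ≤ P.root' i (x -ᵥ o) := by
    rw [Filter.eventually_all]
    intro i
    by_cases hi : ∃ k : ℤ, P.root' i (x -ᵥ o) = k
    · simp [hw _ ⟨i, rfl⟩ hi]
    · set c := P.root' i (x -ᵥ o) with hc
      have hlt : (⌊c⌋ : ℝ) < c := lt_of_le_of_ne (Int.floor_le c) fun h => hi ⟨_, h.symm⟩
      have hcont : Filter.Tendsto (fun t : ℝ => c + t * P.root' i w) (nhds 0) (nhds c) := by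
        have : Continuous fun t : ℝ => c + t * P.root' i w := by fun_prop
        simpa using this.tendsto 0
      filter_upwards [hcont.eventually (lt_mem_nhds hlt),
        hcont.eventually (gt_mem_nhds (Int.lt_floor_add_one c))] with t h1 h2 k
      have hf : ⌊c + t * P.root' i w⌋ = ⌊c⌋ := Int.floor_eq_iff.2 ⟨h1.le, h2⟩
      rw [← Int.le_floor, ← Int.le_floor, hf]
  obtain ⟨t, ht, ht0⟩ := ((ev.filter_mono nhdsWithin_le_nhds).and
    (self_mem_nhdsWithin : _ ∈ nhdsWithin (0 : ℝ) {0}ᶜ)).exists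
  have hmem : t • w +ᵥ x ∈ facet P p x := by
    rw [mem_facet_iff_of_isSpecial ho]
    intro i k
    rw [vadd_vsub_assoc, map_add, map_smul, smul_eq_mul, add_comm]
    exact ht i k
  rw [h, Set.mem_singleton_iff, ← vsub_eq_zero_iff_eq (G := V), vadd_vsub, smul_eq_zero] at hmem
  exact hmem.resolve_left ht0

/-- The open segment lies in the facet of its midpoint because no wall separates its ends.
Conversely, that facet lies in the line through the ends, and by convexity it cannot reach past an
end without containing that vertex. -/
theorem vertexGraph_adj_of_isEdge (ho : IsSpecial P p o) {x y : Vertex P p}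
    (h : IsEdge (Set.range P.root') ((x : E) -ᵥ o) ((y : E) -ᵥ o)) :
    (vertexGraph P p).Adj x y := by
  have hne : (x : E) ≠ y := fun e => h.ne (by rw [e])
  have hval : ∀ (t : ℝ) (i : ι), P.root' i (AffineMap.lineMap (x : E) (y : E) t -ᵥ o) =
      (1 - t) * P.root' i ((x : E) -ᵥ o) + t * P.root' i ((y : E) -ᵥ o) := by
    intro t i
    rw [AffineMap.lineMap_apply, vadd_vsub_assoc, map_add, map_smul, smul_eq_mul,
      ← vsub_sub_vsub_cancel_right (y : E) x o, map_sub]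
    ring
  have hsep : ∀ (s t : ℝ), s ∈ Set.Ioo (0 : ℝ) 1 → t ∈ Set.Ioo (0 : ℝ) 1 → ∀ i, ∀ k : ℤ,
      (k : ℝ) ≤ (1 - s) * P.root' i ((x : E) -ᵥ o) + s * P.root' i ((y : E) -ᵥ o) →
      (k : ℝ) ≤ (1 - t) * P.root' i ((x : E) -ᵥ o) + t * P.root' i ((y : E) -ᵥ o) := by
    rintro s t ⟨hs0, hs1⟩ ⟨ht0, ht1⟩ i k hk
    obtain ⟨l, ⟨hx1, hx2⟩, hy1, hy2⟩ := h.not_separated _ ⟨i, rfl⟩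
    rcases le_or_gt k l with hkl | hkl
    · have : (k : ℝ) ≤ l := by exact_mod_cast hkl
      nlinarith
    -- Both ends are at most `l + 1`, so an interior value of at least `l + 1` forces both to equal
    -- it.
    · have : (l : ℝ) + 1 ≤ k := by exact_mod_cast hkl
      have hxl : P.root' i ((x : E) -ᵥ o) = l + 1 := by nlinarith
      have hyl : P.root' i ((y : E) -ᵥ o) = l + 1 := by nlinarith
      rw [hxl, hyl] at hk ⊢
      linarith
  set z : E := AffineMap.lineMap (x : E) (y : E) (1 / 2 : ℝ) with hz
  have hsub : ∀ t ∈ Set.Ioo (0 : ℝ) 1, AffineMap.lineMap (x : E) (y : E) t ∈ facet P p z := by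
    intro t ht
    rw [mem_facet_iff_of_isSpecial ho]
    intro i k
    rw [hz, hval, hval]
    exact ⟨hsep _ _ ht (by norm_num) i k, hsep _ _ (by norm_num) ht i k⟩
  -- A vertex does not lie in the facet of another point.
  have hvert : ∀ v : Vertex P p, (v : E) ∈ facet P p z → (v : E) = z := by
    intro v hv
    have hfv := isVertex_iff_facet_eq.1 v.2
    have : z ∈ facet P p (v : E) := fun i k => (hv i k).symm
    rw [hfv] at this
    exact this.symm
  -- The facet is convex along the line through `x` and `y`.
  have hconv : ∀ s t u : ℝ, AffineMap.lineMap (x : E) (y : E) s ∈ facet P p z →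
      AffineMap.lineMap (x : E) (y : E) u ∈ facet P p z → s ≤ t → t ≤ u →
      AffineMap.lineMap (x : E) (y : E) t ∈ facet P p z := by
    intro s t u hs hu hst htu
    rw [mem_facet_iff_of_isSpecial ho] at hs hu ⊢
    intro i k
    rw [← hs i k]
    have h1 := (hs i k).trans (hu i k).symm
    rw [hval, hval] at h1
    rw [hval, hval]
    rcases le_total (P.root' i ((x : E) -ᵥ o)) (P.root' i ((y : E) -ᵥ o)) with hxy | hxy
    · constructor
      · intro h2
        exact h1.2 (by nlinarith)
      · intro h2
        nlinarith
    · constructor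
      · intro h2
        by_contra h3
        nlinarith
      · intro h2
        have := h1.1 h2
        nlinarith
  have hxz : (x : E) ≠ z := fun e =>
    hne ((AffineMap.lineMap_eq_left_iff.1 e.symm).resolve_right (by norm_num))
  have hyz : (y : E) ≠ z := fun e =>
    hne ((AffineMap.lineMap_eq_right_iff.1 e.symm).resolve_right (by norm_num))
  refine ⟨z, ?_⟩
  ext u
  rw [Set.mem_ofPred_eq, sbtw_iff_mem_image_Ioo_and_ne]
  constructor
  · rintro ⟨⟨t, ht, rfl⟩, -⟩
    exact hsub t ht
  · intro hu
    obtain ⟨t, ht⟩ := h.line (u -ᵥ z) (by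
      rintro _ ⟨i, rfl⟩ ⟨k, hxk, hyk⟩
      have hzk : P.root' i (z -ᵥ o) = k := by rw [hz, hval, hxk, hyk]; ring
      rw [← vsub_sub_vsub_cancel_right u z o, map_sub, hzk, root'_eq_of_mem_facet ho hu hzk,
        sub_self])
    have hu' : u = AffineMap.lineMap (x : E) (y : E) (t + 1 / 2) := by
      rw [← vsub_vadd u z, ht, hz, AffineMap.lineMap_apply, AffineMap.lineMap_apply, vadd_vadd,
        vsub_sub_vsub_cancel_right, add_smul]
    have hz' : AffineMap.lineMap (x : E) (y : E) (1 / 2 : ℝ) ∈ facet P p z := hsub _ (by norm_num)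
    refine ⟨⟨t + 1 / 2, ⟨?_, ?_⟩, hu'.symm⟩, hne⟩
    · by_contra! hle
      refine hxz (hvert x ?_)
      simpa using hconv _ 0 _ (hu' ▸ hu) hz' hle (by norm_num)
    · by_contra! hle
      refine hyz (hvert y ?_)
      simpa using hconv _ 1 _ hz' (hu' ▸ hu) (by norm_num) hle

/-- A root changes by at most one along an edge. -/
theorem root'_sub_le_one_of_adj (ho : IsSpecial P p o) {x y : Vertex P p}
    (h : (vertexGraph P p).Adj x y) (i : ι) :
    P.root' i ((x : E) -ᵥ o) ≤ P.root' i ((y : E) -ᵥ o) + 1 := by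
  obtain ⟨z, hz⟩ := h
  by_contra! hlt
  have hne : (x : E) ≠ y := by
    intro e
    rw [e] at hlt
    linarith
  set a := P.root' i ((x : E) -ᵥ o)
  set c := P.root' i ((y : E) -ᵥ o)
  have hval : ∀ t : ℝ, P.root' i (AffineMap.lineMap (x : E) (y : E) t -ᵥ o) =
      (1 - t) * a + t * c := by
    intro t
    rw [AffineMap.lineMap_apply, vadd_vsub_assoc, map_add, map_smul, smul_eq_mul,
      ← vsub_sub_vsub_cancel_right (y : E) x o, map_sub]
    ring
  have key : ∀ s ∈ Set.Ioo c a, ∀ k : ℤ, (k : ℝ) ≤ s ↔ (k : ℝ) ≤ P.root' i (z -ᵥ o) := by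
    rintro s ⟨hs1, hs2⟩ k
    have hpos : 0 < a - c := by linarith
    have hmem : AffineMap.lineMap (x : E) (y : E) ((a - s) / (a - c)) ∈ facet P p z := by
      rw [← hz, Set.mem_ofPred_eq, sbtw_iff_mem_image_Ioo_and_ne]
      exact ⟨⟨_, ⟨div_pos (by linarith) hpos, (div_lt_one hpos).2 (by linarith)⟩, rfl⟩, hne⟩
    rw [mem_facet_iff_of_isSpecial ho] at hmem
    rw [← hmem i k, hval]
    have : (1 - (a - s) / (a - c)) * a + (a - s) / (a - c) * c = s := by
      field_simp
      ring
    rw [this]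
  have h1 := Int.lt_floor_add_one c
  have h2 := Int.floor_le c
  -- The integer `⌊c⌋ + 1` lies strictly between `c` and `a`, so the root passes through it inside
  -- the edge; a smaller value taken there lies on the other side of this wall.
  have h3 := (key (⌊c⌋ + 1) ⟨h1, by linarith⟩ (⌊c⌋ + 1)).1 (by push_cast; rfl)
  have h4 := (key ((c + (⌊c⌋ + 1)) / 2) ⟨by linarith, by linarith⟩ (⌊c⌋ + 1)).2 h3
  push_cast at h4
  linarith

theorem root'_le_of_simplicialDist_le (ho : IsSpecial P p o) {x y : Vertex P p} {r : ℕ}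
    (h : simplicialDist P p x y ≤ r) (i : ι) :
    P.root' i ((x : E) -ᵥ o) ≤ P.root' i ((y : E) -ᵥ o) + r := by
  have hw : ∀ {u v : Vertex P p} (w : (vertexGraph P p).Walk u v),
      P.root' i ((u : E) -ᵥ o) ≤ P.root' i ((v : E) -ᵥ o) + w.length := by
    intro u v w
    induction w with
    | nil => simp
    | cons hadj _ ih =>
      have := root'_sub_le_one_of_adj ho hadj i
      simp only [SimpleGraph.Walk.length_cons]
      push_cast
      linarith
  obtain ⟨w, hlen⟩ := SimpleGraph.exists_walk_of_edist_ne_top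
    (ne_top_of_le_ne_top (ENat.natCast_ne_top r) h)
  have hr : w.length ≤ r := by
    have := hlen.trans_le h
    exact_mod_cast this
  have hr' : (w.length : ℝ) ≤ r := by exact_mod_cast hr
  linarith [hw w]

theorem simplicialDist_le_of_forall_root'_le [Finite ι] {o : Vertex P p}
    (ho : IsSpecial P p (o : E)) (hP : HasDescent (Set.range P.root')) (r : ℕ) (x : Vertex P p)
    (hx : ∀ i, P.root' i ((x : E) -ᵥ (o : E)) ≤ r) : simplicialDist P p x o ≤ r := by
  induction r generalizing x with
  | zero =>
    have h0 : ∀ i, P.root' i ((x : E) -ᵥ (o : E)) = 0 := by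
      intro i
      obtain ⟨j, hj⟩ := exists_root'_eq_neg P i
      have h1 := hx i
      have h2 := hx j
      simp only [hj, LinearMap.neg_apply, Nat.cast_zero] at h1 h2
      linarith
    have hxo : x = o := Subtype.ext <| vsub_eq_zero_iff_eq.1 <|
      isIsolated_of_isVertex ho x.2 _ (by rintro _ ⟨i, rfl⟩ -; exact h0 i)
    simp [simplicialDist, hxo]
  | succ r ih =>
    obtain ⟨y, hy, hxy, hyr⟩ := hP r _ (isIsolated_of_isVertex ho x.2) (by
      rintro _ ⟨i, rfl⟩
      exact_mod_cast hx i)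
    have hyo : (y +ᵥ (o : E)) -ᵥ (o : E) = y := vadd_vsub y _
    let y' : Vertex P p := ⟨y +ᵥ (o : E), isVertex_of_isIsolated ho (by rwa [hyo])⟩
    have hd : simplicialDist P p y' o ≤ r := ih y' fun i => by
      change P.root' i ((y +ᵥ (o : E)) -ᵥ (o : E)) ≤ r
      rw [hyo]
      exact hyr _ ⟨i, rfl⟩
    have h1 : (vertexGraph P p).edist x y' ≤ 1 := by
      rcases hxy with rfl | hxy
      · have : x = y' := Subtype.ext (by simp [y'])
        rw [← this]
        simp
      · have : (vertexGraph P p).Adj x y' :=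
          vertexGraph_adj_of_isEdge ho (by simpa only [y', hyo] using hxy)
        exact (SimpleGraph.edist_eq_one_iff_adj.2 this).le
    calc simplicialDist P p x o ≤ (vertexGraph P p).edist x y' + (vertexGraph P p).edist y' o :=
          SimpleGraph.edist_triangle
      _ ≤ 1 + r := add_le_add h1 hd
      _ = ((r + 1 : ℕ) : ℕ∞) := by push_cast; exact add_comm _ _

end Apartment

/-! ### Domination by the highest root on the closed cone -/

section Dominant

variable {ι M V E : Type*} [AddCommGroup M] [Module ℝ M] [NormedAddCommGroup V]
  [InnerProductSpace ℝ V] [MetricSpace E] [NormedAddTorsor V E]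
  {P : RootPairing ι ℝ M V}

theorem root'_nonneg_of_mem_closedCone [Finite ι] [P.IsRootSystem] {b : P.Base} {o x : E} (hx : x ∈ closedCone b o) {i : ι}
    (hi : i ∈ b.support) : 0 ≤ P.root' i (x -ᵥ o) := by
  have : FiniteDimensional ℝ V := by
    have h := RootPairing.IsRootSystem.span_coroot_eq_top (P := P)
    exact ⟨h ▸ Submodule.fg_span (Set.finite_range _)⟩
  have hcont : Continuous fun y : E => P.root' i (y -ᵥ o) :=
    (LinearMap.continuous_of_finiteDimensional (P.root' i)).comp
      (continuous_id.vsub continuous_const)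
  refine closure_minimal (t := {y : E | 0 ≤ P.root' i (y -ᵥ o)}) ?_
    (isClosed_le continuous_const hcont) hx
  rintro _ ⟨v, hv, rfl⟩
  simpa using (hv i hi).le

theorem root'_le_of_isHighestRoot {b : P.Base} {i₀ : ι} (h : IsHighestRoot b i₀) {v : V}
    (hv : ∀ i ∈ b.support, 0 ≤ P.root' i v) (i : ι) : P.root' i v ≤ P.root' i₀ v := by
  have key : ∀ m ∈ AddSubmonoid.closure (P.root '' b.support), 0 ≤ P.toLinearMap m v := by
    intro m hm
    induction hm using AddSubmonoid.closure_induction with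
    | mem m hm =>
      obtain ⟨j, hj, rfl⟩ := hm
      exact hv j hj
    | zero => simp
    | add m m' _ _ h1 h2 => simpa using add_nonneg h1 h2
  have := key _ (h i)
  rw [map_sub, LinearMap.sub_apply, sub_nonneg] at this
  exact this

end Dominant

end SplitApartment

namespace SplitApartment

open Module ClassicalRoots

section Functionals

variable {V : Type*} [AddCommGroup V] [Module ℝ V]

theorem IsIsolated.mono {Φ Ψ : Set (Dual ℝ V)} (hΦΨ : Φ ⊆ Ψ) {x : V} (h : IsIsolated Φ x) :
    IsIsolated Ψ x :=
  fun w hw => h w fun f hf => hw f (hΦΨ hf)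

end Functionals

/-! ### Types B, C and D in doubled integer coordinates -/

section Coordinates

variable {n : ℕ}

/-- The point of `ℝ ^ n` with coordinates `X i / 2`. -/
noncomputable def halfVec (X : Fin n → ℤ) : Fin n → ℝ := fun i => (X i : ℝ) / 2

theorem mem_rootsD_iff {f : Dual ℝ (Fin n → ℝ)} :
    f ∈ rootsD n ↔ ∃ i j, i ≠ j ∧ ∃ s t : ℤ, (s = 1 ∨ s = -1) ∧ (t = 1 ∨ t = -1) ∧
      f = (s : ℝ) • χ i + (t : ℝ) • χ j := by
  constructor
  · rintro ⟨i, j, hij, s, hs, t, ht, rfl⟩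
    refine ⟨i, j, hij.ne, ?_⟩
    rcases hs with rfl | rfl <;> rcases ht with rfl | rfl
    exacts [⟨1, 1, by simp⟩, ⟨1, -1, by simp⟩, ⟨-1, 1, by simp⟩, ⟨-1, -1, by simp⟩]
  · rintro ⟨i, j, hij, s, t, hs, ht, rfl⟩
    have hs' : (s : ℝ) ∈ ({1, -1} : Set ℝ) := by rcases hs with rfl | rfl <;> simp
    have ht' : (t : ℝ) ∈ ({1, -1} : Set ℝ) := by rcases ht with rfl | rfl <;> simp
    rcases lt_or_gt_of_ne hij with h | h
    · exact ⟨i, j, h, s, hs', t, ht', rfl⟩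
    · exact ⟨j, i, h, t, ht', s, hs', add_comm _ _⟩

theorem mem_rootsB_iff {f : Dual ℝ (Fin n → ℝ)} :
    f ∈ rootsB n ↔ f ∈ rootsD n ∨ ∃ i, ∃ s : ℤ, (s = 1 ∨ s = -1) ∧ f = (s : ℝ) • χ i := by
  refine or_congr Iff.rfl ⟨?_, ?_⟩
  · rintro ⟨i, s, hs, rfl⟩
    rcases hs with rfl | rfl
    exacts [⟨i, 1, by simp⟩, ⟨i, -1, by simp⟩]
  · rintro ⟨i, s, hs, rfl⟩
    exact ⟨i, s, by rcases hs with rfl | rfl <;> simp, rfl⟩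

theorem mem_rootsC_iff {f : Dual ℝ (Fin n → ℝ)} :
    f ∈ rootsC n ↔
      f ∈ rootsD n ∨ ∃ i, ∃ s : ℤ, (s = 1 ∨ s = -1) ∧ f = (2 * s : ℝ) • χ i := by
  refine or_congr Iff.rfl ⟨?_, ?_⟩
  · rintro ⟨i, s, hs, rfl⟩
    rcases hs with rfl | rfl
    exacts [⟨i, 1, by simp⟩, ⟨i, -1, by simp⟩]
  · rintro ⟨i, s, hs, rfl⟩
    exact ⟨i, s, by rcases hs with rfl | rfl <;> simp, rfl⟩

theorem smul_χ_add_smul_χ_apply (s t : ℝ) (i j : Fin n) (x : Fin n → ℝ) :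
    (s • χ i + t • χ j) x = s * x i + t * x j := rfl

theorem smul_χ_apply (s : ℝ) (i : Fin n) (x : Fin n → ℝ) : (s • χ i) x = s * x i := rfl

theorem root_halfVec (s t : ℤ) (i j : Fin n) (X : Fin n → ℤ) :
    ((s : ℝ) • χ i + (t : ℝ) • χ j) (halfVec X) = ((s * X i + t * X j : ℤ) : ℝ) / 2 := by
  rw [smul_χ_add_smul_χ_apply]
  simp only [halfVec]
  push_cast
  ring

theorem eq_halfVec_of_isIsolated {x : Fin n → ℝ} (h : IsIsolated (rootsC n) x) :
    ∃ X : Fin n → ℤ, x = halfVec X := by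
  classical
  suffices H : ∀ i, ∃ k : ℤ, 2 * x i = k by
    choose X hX using H
    exact ⟨X, funext fun i => by rw [halfVec, ← hX]; ring⟩
  intro i
  by_contra hi
  -- Moving the coordinates congruent to `± x i` in opposite directions preserves all walls.
  set w : Fin n → ℝ := fun j => if ∃ k : ℤ, x j - x i = k then 1 else
    if ∃ k : ℤ, x j + x i = k then -1 else 0 with hw
  -- Both congruences together would make `2 * x i` an integer.
  have hexcl : ∀ j, (∃ k : ℤ, x j - x i = k) → ¬ ∃ k : ℤ, x j + x i = k := by
    rintro j ⟨k, hk⟩ ⟨l, hl⟩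
    exact hi ⟨l - k, by push_cast; linarith⟩
  have hsub : ∀ j k, (∃ l : ℤ, x j - x k = l) → w j = w k := by
    rintro j k ⟨l, hl⟩
    have h1 : (∃ l : ℤ, x j - x i = l) ↔ ∃ l : ℤ, x k - x i = l :=
      ⟨fun ⟨m, hm⟩ => ⟨m - l, by push_cast; linarith⟩,
        fun ⟨m, hm⟩ => ⟨m + l, by push_cast; linarith⟩⟩
    have h2 : (∃ l : ℤ, x j + x i = l) ↔ ∃ l : ℤ, x k + x i = l :=
      ⟨fun ⟨m, hm⟩ => ⟨m - l, by push_cast; linarith⟩,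
        fun ⟨m, hm⟩ => ⟨m + l, by push_cast; linarith⟩⟩
    simp only [hw, h1, h2]
  have hadd : ∀ j k, (∃ l : ℤ, x j + x k = l) → w j = -w k := by
    rintro j k ⟨l, hl⟩
    have h1 : (∃ l : ℤ, x j - x i = l) ↔ ∃ l : ℤ, x k + x i = l :=
      ⟨fun ⟨m, hm⟩ => ⟨l - m, by push_cast; linarith⟩,
        fun ⟨m, hm⟩ => ⟨l - m, by push_cast; linarith⟩⟩
    have h2 : (∃ l : ℤ, x j + x i = l) ↔ ∃ l : ℤ, x k - x i = l :=
      ⟨fun ⟨m, hm⟩ => ⟨l - m, by push_cast; linarith⟩,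
        fun ⟨m, hm⟩ => ⟨l - m, by push_cast; linarith⟩⟩
    have := hexcl k
    simp only [hw, h1, h2]
    split_ifs <;> simp_all
  have h0 : w = 0 := by
    refine h w fun f hf hk => ?_
    rcases mem_rootsC_iff.1 hf with hf | ⟨j, s, hs, rfl⟩
    · obtain ⟨j, k, -, s, t, hs, ht, rfl⟩ := mem_rootsD_iff.1 hf
      obtain ⟨l, hl⟩ := hk
      rw [smul_χ_add_smul_χ_apply] at hl ⊢
      rcases hs with rfl | rfl <;> rcases ht with rfl | rfl <;> push_cast at hl ⊢
      · linarith [hadd j k ⟨l, by linarith⟩]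
      · linarith [hsub j k ⟨l, by linarith⟩]
      · linarith [hsub j k ⟨-l, by push_cast; linarith⟩]
      · linarith [hadd j k ⟨-l, by push_cast; linarith⟩]
    · obtain ⟨l, hl⟩ := hk
      rw [smul_χ_apply] at hl ⊢
      rcases hs with rfl | rfl <;> push_cast at hl ⊢
      · linarith [hadd j j ⟨l, by linarith⟩]
      · linarith [hadd j j ⟨-l, by push_cast; linarith⟩]
  have := congrFun h0 i
  simp only [hw, sub_self, Pi.zero_apply] at this
  rw [if_pos ⟨0, by simp⟩] at this
  norm_num at this

theorem isIsolated_rootsC_halfVec (X : Fin n → ℤ) : IsIsolated (rootsC n) (halfVec X) := by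
  intro w hw
  funext i
  have := hw _ (mem_rootsC_iff.2 (Or.inr ⟨i, 1, Or.inl rfl, rfl⟩))
    ⟨X i, by rw [smul_χ_apply, halfVec]; push_cast; ring⟩
  rw [smul_χ_apply] at this
  push_cast at this
  simpa using this

/-- If the roots `χ i + χ j` and `χ i - χ j` vanish at `w`, then so does `χ i`. -/
theorem apply_eq_zero_of_rootsD {w : Fin n → ℝ} {i j : Fin n}
    (h : ∀ t : ℤ, t = 1 ∨ t = -1 → (((1 : ℤ) : ℝ) • χ i + (t : ℝ) • χ j) w = 0) : w i = 0 := by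
  have h1 := h 1 (Or.inl rfl)
  have h2 := h (-1) (Or.inr rfl)
  rw [smul_χ_add_smul_χ_apply] at h1 h2
  push_cast at h1 h2
  linarith

/-- A partner of the same parity makes both `χ i + χ j` and `χ i - χ j` integral at the point. -/
theorem isIsolated_rootsD_halfVec {X : Fin n → ℤ} (hX : ∀ i, ∃ j, i ≠ j ∧ 2 ∣ X i - X j) :
    IsIsolated (rootsD n) (halfVec X) := by
  intro w hw
  funext i
  obtain ⟨j, hij, hd⟩ := hX i
  refine apply_eq_zero_of_rootsD (j := j) fun t ht => hw _
    (mem_rootsD_iff.2 ⟨i, j, hij, 1, t, Or.inl rfl, ht, rfl⟩) ?_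
  have : 2 ∣ 1 * X i + t * X j := by rcases ht with rfl | rfl <;> omega
  obtain ⟨l, hl⟩ := this
  exact ⟨l, by rw [root_halfVec, hl]; push_cast; ring⟩

/-- Here `a` and `b` are doubled values of a functional at two points, so unit slabs become
intervals from one even integer to the next. -/
theorem exists_slab {a b : ℤ} (h : a - b ≤ 1 ∧ b - a ≤ 1 ∨ 2 ∣ a ∧ a - b ≤ 2 ∧ b - a ≤ 2) :
    ∃ k : ℤ, ((k : ℝ) ≤ (a : ℝ) / 2 ∧ (a : ℝ) / 2 ≤ k + 1) ∧
      ((k : ℝ) ≤ (b : ℝ) / 2 ∧ (b : ℝ) / 2 ≤ k + 1) := by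
  obtain ⟨k, h1, h2, h3, h4⟩ : ∃ k : ℤ, 2 * k ≤ a ∧ a ≤ 2 * k + 2 ∧ 2 * k ≤ b ∧ b ≤ 2 * k + 2 :=
    ⟨min a b / 2, by omega⟩
  rify at h1 h2 h3 h4
  exact ⟨k, ⟨by linarith, by linarith⟩, by linarith, by linarith⟩

/-- Lowering by `± 1 / 2` coordinates that are congruent modulo `1` gives an edge, if the other
coordinates are determined by the walls through both ends. -/
theorem isEdge_halfVec {Φ : Set (Dual ℝ (Fin n → ℝ))} (hD : rootsD n ⊆ Φ)
    (hΦ : ∀ f ∈ Φ, f ∈ rootsD n ∨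
      ∃ i, ∃ c s : ℤ, (c = 1 ∨ c = 2) ∧ (s = 1 ∨ s = -1) ∧ f = (c * s : ℝ) • χ i)
    {X Y σ : Fin n → ℤ} {S : Set (Fin n)} (hS : S.Nonempty) (hσ : ∀ i, σ i = 1 ∨ σ i = -1)
    (hYS : ∀ i ∈ S, Y i = X i - σ i) (hY : ∀ i ∉ S, Y i = X i)
    (hpar : ∀ i ∈ S, ∀ j ∈ S, 2 ∣ X i - X j)
    (hfix : ∀ w : Fin n → ℝ,
      (∀ f ∈ Φ, (∃ k : ℤ, f (halfVec X) = k ∧ f (halfVec Y) = k) → f w = 0) →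
        ∀ i ∉ S, w i = 0) : IsEdge Φ (halfVec X) (halfVec Y) where
  ne h := by
    obtain ⟨i, hi⟩ := hS
    have h1 := congrFun h i
    simp only [halfVec, hYS i hi] at h1
    have h2 : (X i : ℝ) = ((X i - σ i : ℤ) : ℝ) := by linarith
    have h3 : X i = X i - σ i := by exact_mod_cast h2
    have := hσ i
    omega
  not_separated f hf := by
    have hch : ∀ i, (i ∈ S ∧ Y i = X i - σ i) ∨ Y i = X i := fun i =>
      (em (i ∈ S)).imp (fun h => ⟨h, hYS i h⟩) (hY i)
    rcases hΦ f hf with hf | ⟨i, c, s, hc, hs, rfl⟩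
    · obtain ⟨i, j, -, s, t, hs, ht, rfl⟩ := mem_rootsD_iff.1 hf
      rw [root_halfVec, root_halfVec]
      apply exists_slab
      have hi := hσ i
      have hj := hσ j
      rcases hch i with ⟨hiS, hi'⟩ | hi' <;> rcases hch j with ⟨hjS, hj'⟩ | hj' <;>
        rw [hi', hj']
      · have := hpar i hiS j hjS
        rcases hs with rfl | rfl <;> rcases ht with rfl | rfl <;> omega
      all_goals rcases hs with rfl | rfl <;> rcases ht with rfl | rfl <;> omega
    · have hi := hσ i
      rw [smul_χ_apply, smul_χ_apply]
      simp only [halfVec]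
      rcases hc with rfl | rfl
      · have := @exists_slab (s * X i) (s * Y i) (by
          rcases hch i with ⟨-, hi'⟩ | hi' <;> rw [hi'] <;> rcases hs with rfl | rfl <;> omega)
        convert this using 6 <;> push_cast <;> ring
      · have := @exists_slab (2 * (s * X i)) (2 * (s * Y i)) (by
          rcases hch i with ⟨-, hi'⟩ | hi' <;> rw [hi'] <;> rcases hs with rfl | rfl <;> omega)
        convert this using 6 <;> push_cast <;> ring
  line w hw := by
    obtain ⟨i, hi⟩ := hS
    have hσσ : ∀ j, (σ j : ℝ) * σ j = 1 := fun j => by rcases hσ j with h | h <;> simp [h]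
    -- On `S` the displacement is `-σ / 2`, and `σ * w` will be constant there.
    refine ⟨-2 * (σ i * w i), funext fun j => ?_⟩
    simp only [Pi.smul_apply, Pi.sub_apply, smul_eq_mul, halfVec]
    by_cases hj : j ∈ S
    -- The root `σ i χ i - σ j χ j` is integral by parity and unchanged by the move.
    · have key : (σ i : ℝ) * w i = σ j * w j := by
        by_cases hij : i = j
        · rw [hij]
        have hpar' : 2 ∣ σ i * X i + -σ j * X j := by
          have h1 := hpar i hi j hj
          rcases hσ i with h | h <;> rcases hσ j with h' | h' <;> rw [h, h'] <;> omega
        obtain ⟨k, hk⟩ := hpar'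
        have hk' : σ i * Y i + -σ j * Y j = 2 * k := by
          rw [← hk, hYS i hi, hYS j hj]
          rcases hσ i with h | h <;> rcases hσ j with h' | h' <;> rw [h, h'] <;> ring
        have := hw _ (hD (mem_rootsD_iff.2 ⟨i, j, hij, σ i, -σ j, hσ i,
          by rcases hσ j with h | h <;> simp [h], rfl⟩))
          ⟨k, by rw [root_halfVec, hk]; push_cast; ring, by rw [root_halfVec, hk']; push_cast; ring⟩
        rw [smul_χ_add_smul_χ_apply] at this
        push_cast at this
        linarith
      rw [key, hYS j hj]
      push_cast
      linear_combination -(w j) * hσσ j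
    · rw [hY j hj, hfix w hw j hj]
      simp

/-- Two vectors with even entries, differing by `± 2` in the only nonzero entry, span an edge. -/
theorem isEdge_halfVec_of_single {Φ : Set (Dual ℝ (Fin n → ℝ))} (hn : 3 ≤ n) (hD : rootsD n ⊆ Φ)
    (hΦ : ∀ f ∈ Φ, f ∈ rootsD n ∨ ∃ i, ∃ s : ℤ, (s = 1 ∨ s = -1) ∧ f = (s : ℝ) • χ i)
    {X Y : Fin n → ℤ} {i : Fin n} (hX : ∀ j, i ≠ j → X j = 0) (hXi : 2 ∣ X i)
    (hYi : Y i = X i - 2 ∨ Y i = X i + 2) (hY : ∀ j, i ≠ j → Y j = 0) :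
    IsEdge Φ (halfVec X) (halfVec Y) where
  ne h := by
    have h1 := congrFun h i
    simp only [halfVec] at h1
    have h2 : (X i : ℝ) = Y i := by linarith
    have h3 : X i = Y i := by exact_mod_cast h2
    omega
  not_separated f hf := by
    have hXj : ∀ j, 2 ∣ X j ∧ (j = i ∨ X j = 0 ∧ Y j = 0) := fun j => by
      by_cases hij : i = j
      · exact ⟨hij ▸ hXi, Or.inl hij.symm⟩
      · simp [hX j hij, hY j hij]
    rcases hΦ f hf with hf | ⟨j, s, hs, rfl⟩
    · obtain ⟨j, k, hjk, s, t, hs, ht, rfl⟩ := mem_rootsD_iff.1 hf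
      rw [root_halfVec, root_halfVec]
      apply exists_slab
      obtain ⟨hj1, hj2⟩ := hXj j
      obtain ⟨hk1, hk2⟩ := hXj k
      rcases hj2 with rfl | ⟨hj2, hj3⟩
      · obtain ⟨hk2, hk3⟩ := hk2.resolve_left hjk.symm
        rcases hs with rfl | rfl <;> rcases ht with rfl | rfl <;> omega
      · rw [hj2, hj3]
        rcases hk2 with rfl | ⟨hk2, hk3⟩
        · rcases hs with rfl | rfl <;> rcases ht with rfl | rfl <;> omega
        · rcases hs with rfl | rfl <;> rcases ht with rfl | rfl <;> omega
    · rw [smul_χ_apply, smul_χ_apply]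
      simp only [halfVec]
      have := @exists_slab (s * X j) (s * Y j) (by
        obtain ⟨hj1, rfl | ⟨hj2, hj3⟩⟩ := hXj j
        · rcases hs with rfl | rfl <;> omega
        · simp [hj2, hj3])
      convert this using 6 <;> push_cast <;> ring
  line w hw := by
    have h0 : ∀ j, i ≠ j → w j = 0 := by
      intro j hij
      -- A third index exists as `3 ≤ n`; the roots `χ j ± χ k` vanish at both ends and pin down `w
      -- j`.
      obtain ⟨k, hk⟩ : ∃ k, k ∉ ({i, j} : Finset (Fin n)) := by
        by_contra! hall
        have h1 : (Finset.univ : Finset (Fin n)) ⊆ {i, j} := fun k _ => hall k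
        have h2 := Finset.card_le_card h1
        have h3 := Finset.card_le_two (a := i) (b := j)
        rw [Finset.card_univ, Fintype.card_fin] at h2
        omega
      simp only [Finset.mem_insert, Finset.mem_singleton, not_or] at hk
      refine apply_eq_zero_of_rootsD (j := k) fun t ht => hw _
        (hD (mem_rootsD_iff.2 ⟨j, k, fun h => hk.2 h.symm, 1, t, Or.inl rfl, ht, rfl⟩)) ⟨0, ?_, ?_⟩
      · rw [root_halfVec, hX j hij, hX k (Ne.symm hk.1)]; simp
      · rw [root_halfVec, hY j hij, hY k (Ne.symm hk.1)]; simp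
    rcases hYi with hYi | hYi
    · refine ⟨-w i, funext fun j => ?_⟩
      simp only [Pi.smul_apply, Pi.sub_apply, smul_eq_mul, halfVec]
      by_cases hij : i = j
      · rw [← hij, hYi]; push_cast; ring
      · rw [h0 j hij, hX j hij, hY j hij]; simp
    · refine ⟨w i, funext fun j => ?_⟩
      simp only [Pi.smul_apply, Pi.sub_apply, smul_eq_mul, halfVec]
      by_cases hij : i = j
      · rw [← hij, hYi]; push_cast; ring
      · rw [h0 j hij, hX j hij, hY j hij]; simp

theorem natAbs_add_natAbs_le_of_rootsD {X : Fin n → ℤ} {r : ℕ}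
    (h : ∀ f ∈ rootsD n, f (halfVec X) ≤ r) {i j : Fin n} (hij : i ≠ j) :
    (X i).natAbs + (X j).natAbs ≤ 2 * r := by
  have key : ∀ s t : ℤ, (s = 1 ∨ s = -1) → (t = 1 ∨ t = -1) → s * X i + t * X j ≤ 2 * r := by
    intro s t hs ht
    have := h _ (mem_rootsD_iff.2 ⟨i, j, hij, s, t, hs, ht, rfl⟩)
    rw [root_halfVec] at this
    rify
    push_cast at this
    linarith
  have h1 := key 1 1 (by simp) (by simp)
  have h2 := key 1 (-1) (by simp) (by simp)
  have h3 := key (-1) 1 (by simp) (by simp)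
  have h4 := key (-1) (-1) (by simp) (by simp)
  omega

theorem rootsD_halfVec_le {Y : Fin n → ℤ} {r : ℕ}
    (h : ∀ i j, i ≠ j → (Y i).natAbs + (Y j).natAbs ≤ 2 * r) :
    ∀ f ∈ rootsD n, f (halfVec Y) ≤ r := by
  intro f hf
  obtain ⟨i, j, hij, s, t, hs, ht, rfl⟩ := mem_rootsD_iff.1 hf
  have h1 := h i j hij
  have h2 : s * Y i + t * Y j ≤ 2 * r := by
    rcases hs with rfl | rfl <;> rcases ht with rfl | rfl <;> omega
  rw [root_halfVec]
  rify at h2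
  push_cast
  linarith

/-- Every half-integral point is a vertex here, and the bound on the roots `± 2 χ i` implies the
bound on the others. It is enough to shrink the entries with `|X i| = r + 1`, which share a parity;
the rest are pinned by `2 χ i`. -/
theorem hasDescent_rootsC (n : ℕ) : HasDescent (rootsC n) := by
  intro r x hx hr
  obtain ⟨X, rfl⟩ := eq_halfVec_of_isIsolated hx
  have hX : ∀ i, (X i).natAbs ≤ r + 1 := by
    intro i
    have key : ∀ s : ℤ, (s = 1 ∨ s = -1) → s * X i ≤ r + 1 := by
      intro s hs
      have := hr _ (mem_rootsC_iff.2 (Or.inr ⟨i, s, hs, rfl⟩))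
      rw [smul_χ_apply, halfVec] at this
      rify
      linarith
    have h1 := key 1 (by simp)
    have h2 := key (-1) (by simp)
    omega
  set σ : Fin n → ℤ := fun i => if 0 < X i then 1 else -1 with hσ
  set S : Set (Fin n) := {i | (X i).natAbs = r + 1} with hS
  classical
  set Y : Fin n → ℤ := fun i => if i ∈ S then X i - σ i else X i with hY
  have hYS : ∀ i ∈ S, Y i = X i - σ i := fun i hi => if_pos hi
  have hYS' : ∀ i ∉ S, Y i = X i := fun i hi => if_neg hi
  have hσ1 : ∀ i, σ i = 1 ∨ σ i = -1 := fun i => by simp only [hσ]; split_ifs <;> simp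
  have hYr : ∀ i, (Y i).natAbs ≤ r := by
    intro i
    have h1 := hX i
    by_cases hi : i ∈ S
    · have h2 : (X i).natAbs = r + 1 := hi
      rw [hYS i hi]
      simp only [hσ]
      split_ifs <;> omega
    · have h2 : (X i).natAbs ≠ r + 1 := hi
      rw [hYS' i hi]
      omega
  refine ⟨halfVec Y, isIsolated_rootsC_halfVec Y, ?_, ?_⟩
  · rcases S.eq_empty_or_nonempty with hemp | hne
    · left
      congr 1
      funext i
      exact hYS' i (by simp [hemp])
    · right
      refine isEdge_halfVec (fun f hf => Or.inl hf) ?_ hne hσ1 hYS hYS' ?_ ?_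
      · intro f hf
        refine (mem_rootsC_iff.1 hf).imp_right ?_
        rintro ⟨i, s, hs, rfl⟩
        exact ⟨i, 2, s, Or.inr rfl, hs, by push_cast; rfl⟩
      · intro i hi j hj
        have h1 : (X i).natAbs = r + 1 := hi
        have h2 : (X j).natAbs = r + 1 := hj
        omega
      · intro w hw i hi
        have := hw _ (mem_rootsC_iff.2 (Or.inr ⟨i, 1, Or.inl rfl, rfl⟩))
          ⟨X i, by rw [smul_χ_apply, halfVec]; push_cast; ring,
            by rw [smul_χ_apply, halfVec, hYS' i hi]; push_cast; ring⟩
        rw [smul_χ_apply] at this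
        push_cast at this
        simpa using this
  · intro f hf
    rcases mem_rootsC_iff.1 hf with hf | ⟨i, s, hs, rfl⟩
    · refine rootsD_halfVec_le (fun i j _ => ?_) f hf
      have := hYr i
      have := hYr j
      omega
    · have h1 := hYr i
      have h2 : s * Y i ≤ r := by rcases hs with rfl | rfl <;> omega
      rw [smul_χ_apply, halfVec]
      rify at h2
      linarith

/-! ### Descent in types B and D -/

/-- If the two largest absolute values of the entries of `X` add up to at most `2 * (r + 1)`, and no
entry is `± 2 * (r + 1)`, then reducing the absolute values of all the entries of a suitable parity
brings that sum down to at most `2 * r`. -/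
theorem exists_parity_lowering {X : Fin n → ℤ} {r : ℕ}
    (h : ∀ i j, i ≠ j → (X i).natAbs + (X j).natAbs ≤ 2 * (r + 1))
    (hne : ∀ i, (X i).natAbs ≠ 2 * (r + 1)) :
    ∃ c : ℤ, ∀ Y : Fin n → ℤ,
      (∀ i, 2 ∣ X i - c → Y i = X i - if 0 < X i then 1 else -1) →
      (∀ i, ¬ 2 ∣ X i - c → Y i = X i) →
      ∀ i j, i ≠ j → (Y i).natAbs + (Y j).natAbs ≤ 2 * r := by
  by_cases hbig : ∃ i, r + 1 < (X i).natAbs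
  · obtain ⟨i₁, hi₁⟩ := hbig
    refine ⟨X i₁, fun Y hY hY' => ?_⟩
    -- Zero entries in the chosen class become `1`. This is harmless because then `X i₁` is even,
    -- hence at most `2 * r` in absolute value.
    have hlow := hne i₁
    have h1 : ∀ j, i₁ ≠ j → (Y i₁).natAbs + (Y j).natAbs ≤ 2 * r ∧ (Y j).natAbs ≤ r := by
      intro j hj
      have a1 := h i₁ j hj
      have a2 := hY i₁ (by simp)
      have a3 := hY j
      have a4 := hY' j
      by_cases hd : 2 ∣ X j - X i₁
      · replace a3 := a3 hd
        split_ifs at a2 a3 <;> omega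
      · replace a4 := a4 hd
        split_ifs at a2 <;> omega
    intro i j hij
    by_cases hi : i₁ = i
    · subst hi
      exact (h1 j hij).1
    · by_cases hj : i₁ = j
      · subst hj
        rw [add_comm]
        exact (h1 i hi).1
      · have := (h1 i hi).2
        have := (h1 j hj).2
        omega
  · push Not at hbig
    refine ⟨r + 1, fun Y hY hY' => ?_⟩
    have h1 : ∀ i, (Y i).natAbs ≤ r := by
      intro i
      have a1 := hbig i
      by_cases hd : 2 ∣ X i - (r + 1)
      · have a2 := hY i hd
        split_ifs at a2 <;> omega
      · have a2 := hY' i hd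
        omega
    intro i j _
    have := h1 i
    have := h1 j
    omega

/-- Types B and D share the move and differ only in which walls pin the unmoved coordinates, which
is left to `hfix`. -/
theorem hasDescent_of_rootsD_subset {Φ : Set (Dual ℝ (Fin n → ℝ))} (hn : 3 ≤ n)
    (hD : rootsD n ⊆ Φ)
    (hΦ : ∀ f ∈ Φ, f ∈ rootsD n ∨ ∃ i, ∃ s : ℤ, (s = 1 ∨ s = -1) ∧ f = (s : ℝ) • χ i)
    (hfix : ∀ X Y : Fin n → ℤ, IsIsolated Φ (halfVec X) →
      ∀ i, (∀ j, 2 ∣ X i - X j → Y j = X j) → ∀ w : Fin n → ℝ,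
      (∀ f ∈ Φ, (∃ k : ℤ, f (halfVec X) = k ∧ f (halfVec Y) = k) → f w = 0) → w i = 0) :
    HasDescent Φ := by
  classical
  intro r x hx hr
  have hne : ∀ i : Fin n, ∃ j, i ≠ j := fun i =>
    have : Nontrivial (Fin n) := Fin.nontrivial_iff_two_le.2 (by omega)
    (exists_ne i).imp fun _ h => h.symm
  have hxC : IsIsolated (rootsC n) x := by
    refine fun w hw => hx w fun f hf hk => ?_
    rcases hΦ f hf with hf | ⟨i, s, hs, rfl⟩
    · exact hw f (Or.inl hf) hk
    · obtain ⟨k, hk⟩ := hk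
      have := hw _ (mem_rootsC_iff.2 (Or.inr ⟨i, s, hs, rfl⟩)) ⟨2 * k, by
        rw [smul_χ_apply] at hk ⊢
        push_cast
        linarith⟩
      rw [smul_χ_apply] at this ⊢
      linarith
  obtain ⟨X, rfl⟩ := eq_halfVec_of_isIsolated hxC
  have hX : ∀ i j, i ≠ j → (X i).natAbs + (X j).natAbs ≤ 2 * (r + 1) := fun i j hij =>
    natAbs_add_natAbs_le_of_rootsD (fun f hf => by exact_mod_cast hr f (hD hf)) hij
  suffices H : ∃ Y : Fin n → ℤ, (∀ i j, 2 ∣ Y i - Y j ∨ Y = X) ∧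
      (Y = X ∨ IsEdge Φ (halfVec X) (halfVec Y)) ∧
      ∀ i j, i ≠ j → (Y i).natAbs + (Y j).natAbs ≤ 2 * r by
    obtain ⟨Y, hpar, hedge, hYr⟩ := H
    refine ⟨halfVec Y, ?_, hedge.imp_left fun h => by rw [h], fun f hf => ?_⟩
    · by_cases hYX : Y = X
      · rwa [hYX]
      · refine (isIsolated_rootsD_halfVec fun i => ?_).mono hD
        obtain ⟨j, hij⟩ := hne i
        exact ⟨j, hij, (hpar i j).resolve_right hYX⟩
    · rcases hΦ f hf with hf | ⟨i, s, hs, rfl⟩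
      · exact rootsD_halfVec_le hYr f hf
      · obtain ⟨j, hij⟩ := hne i
        have h1 := hYr i j hij
        have h2 : s * Y i ≤ 2 * r := by rcases hs with rfl | rfl <;> omega
        rw [smul_χ_apply, halfVec]
        rify at h2
        linarith
  -- Shrinking a parity class fails here: `2 * (r + 1)` would drop to `2 * r + 1` while the zero
  -- entries grow to `1`.
  by_cases hmax : ∃ i, (X i).natAbs = 2 * (r + 1)
  · obtain ⟨i, hi⟩ := hmax
    have hX0 : ∀ j, i ≠ j → X j = 0 := fun j hij => by
      have := hX i j hij
      omega
    set Y : Fin n → ℤ := fun j => if i = j then (if 0 < X i then X i - 2 else X i + 2) else 0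
      with hY
    have hYi : Y i = if 0 < X i then X i - 2 else X i + 2 := if_pos rfl
    have hY0 : ∀ j, i ≠ j → Y j = 0 := fun j hij => if_neg hij
    have hYe : ∀ j, 2 ∣ Y j := fun j => by
      by_cases hij : i = j
      · subst hij
        split_ifs at hYi <;> omega
      · simp [hY0 j hij]
    refine ⟨Y, fun j k => Or.inl (dvd_sub (hYe j) (hYe k)),
      Or.inr (isEdge_halfVec_of_single hn hD hΦ hX0 (by omega) (by split_ifs at hYi <;> omega) hY0),
      fun j k hjk => ?_⟩
    by_cases hij : i = j
    · subst hij
      rw [hY0 k hjk]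
      split_ifs at hYi <;> omega
    · rw [hY0 j hij]
      by_cases hik : i = k
      · subst hik
        split_ifs at hYi <;> omega
      · simp [hY0 k hik]
  · push Not at hmax
    obtain ⟨c, hc⟩ := exists_parity_lowering hX hmax
    set σ : Fin n → ℤ := fun i => if 0 < X i then 1 else -1 with hσ
    set S : Set (Fin n) := {i | 2 ∣ X i - c} with hS
    set Y : Fin n → ℤ := fun i => if i ∈ S then X i - σ i else X i with hY
    have hYS : ∀ i ∈ S, Y i = X i - σ i := fun i hi => if_pos hi
    have hYS' : ∀ i ∉ S, Y i = X i := fun i hi => if_neg hi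
    have hσ1 : ∀ i, σ i = 1 ∨ σ i = -1 := fun i => by simp only [hσ]; split_ifs <;> simp
    refine ⟨Y, fun i j => Or.inl ?_, ?_, hc Y hYS hYS'⟩
    -- The moved class joins the other parity, so all entries of `Y` are congruent and `Y` gives a
    -- vertex.
    · have key : ∀ i, 2 ∣ Y i - (c + 1) := by
        intro i
        by_cases hi : i ∈ S
        · have h1 : 2 ∣ X i - c := hi
          rw [hYS i hi]
          rcases hσ1 i with h | h <;> omega
        · have h1 : ¬ 2 ∣ X i - c := hi
          rw [hYS' i hi]
          omega
      have := key i
      have := key j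
      omega
    · rcases S.eq_empty_or_nonempty with hemp | hne
      · left
        funext i
        exact hYS' i (by simp [hemp])
      · right
        refine isEdge_halfVec hD (fun f hf => ?_) hne hσ1 hYS hYS' ?_ fun w hw i hi =>
          hfix X Y hx i (fun j hj => hYS' j fun hjS => hi ?_) w hw
        · refine (hΦ f hf).imp_right ?_
          rintro ⟨i, s, hs, rfl⟩
          exact ⟨i, 1, s, Or.inl rfl, hs, by simp⟩
        · intro i hi j hj
          have h1 : 2 ∣ X i - c := hi
          have h2 : 2 ∣ X j - c := hj
          omega
        · have h1 : 2 ∣ X j - c := hjS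
          exact (by omega : 2 ∣ X i - c)

/-- A coordinate vanishes if it does not change between two points, another one congruent to it does
not either, and the roots in these coordinates that are integral at both points vanish. -/
theorem apply_eq_zero_of_congruent {Φ : Set (Dual ℝ (Fin n → ℝ))} (hD : rootsD n ⊆ Φ)
    {X Y : Fin n → ℤ} {w : Fin n → ℝ} {i j : Fin n} (hij : i ≠ j) (hX : 2 ∣ X i - X j)
    (hi : Y i = X i) (hj : Y j = X j)
    (hw : ∀ f ∈ Φ, (∃ k : ℤ, f (halfVec X) = k ∧ f (halfVec Y) = k) → f w = 0) : w i = 0 := by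
  refine apply_eq_zero_of_rootsD (j := j) fun t ht => hw _
    (hD (mem_rootsD_iff.2 ⟨i, j, hij, 1, t, Or.inl rfl, ht, rfl⟩)) ?_
  have : 2 ∣ 1 * X i + t * X j := by rcases ht with rfl | rfl <;> omega
  obtain ⟨l, hl⟩ := this
  refine ⟨l, ?_, ?_⟩
  · rw [root_halfVec, hl]; push_cast; ring
  · rw [root_halfVec, hi, hj, hl]; push_cast; ring

/-- The coordinate vector `e i` is killed by the roots of type `D n` that are integral at `x`, if no
other coordinate of `x` is congruent to `x i`. -/
theorem rootsD_single_eq_zero {X : Fin n → ℤ} {i : Fin n} (hi : ∀ j, i ≠ j → ¬ 2 ∣ X i - X j)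
    {f : Dual ℝ (Fin n → ℝ)} (hf : f ∈ rootsD n) (hk : ∃ k : ℤ, f (halfVec X) = k) :
    f (Pi.single i 1) = 0 := by
  obtain ⟨j, k, hjk, s, t, hs, ht, rfl⟩ := mem_rootsD_iff.1 hf
  obtain ⟨l, hl⟩ := hk
  rw [root_halfVec] at hl
  have hl' : s * X j + t * X k = 2 * l := by
    rify
    push_cast at hl
    linarith
  have hd : 2 ∣ X j - X k := by
    rcases hs with rfl | rfl <;> rcases ht with rfl | rfl <;> omega
  have hj : i ≠ j := by
    rintro rfl
    exact hi k hjk hd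
  have hk : i ≠ k := by
    rintro rfl
    exact hi j hj (by omega)
  rw [smul_χ_add_smul_χ_apply, Pi.single_eq_of_ne hj.symm, Pi.single_eq_of_ne hk.symm]
  simp

theorem single_one_ne_zero (i : Fin n) : (Pi.single i 1 : Fin n → ℝ) ≠ 0 := fun h => by
  simpa using congrFun h i

/-- At a vertex no parity class is a single index, since its basis vector would be killed by all
integral roots. An unmoved coordinate therefore has an unmoved partner. -/
theorem hasDescent_rootsD (hn : 3 ≤ n) : HasDescent (rootsD n) := by
  refine hasDescent_of_rootsD_subset hn subset_rfl (fun f hf => Or.inl hf) ?_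
  intro X Y hX i hY w hw
  obtain ⟨j, hij, hd⟩ : ∃ j, i ≠ j ∧ 2 ∣ X i - X j := by
    by_contra! hno
    exact single_one_ne_zero i (hX _ fun f hf hk => rootsD_single_eq_zero hno hf hk)
  exact apply_eq_zero_of_congruent subset_rfl hij hd (hY i (by simp)) (hY j hd) hw

/-- An even entry is pinned by `χ i` itself; an odd one needs a partner, as in type D. -/
theorem hasDescent_rootsB (hn : 3 ≤ n) : HasDescent (rootsB n) := by
  refine hasDescent_of_rootsD_subset hn (fun f hf => Or.inl hf) (fun f hf => mem_rootsB_iff.1 hf) ?_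
  intro X Y hX i hY w hw
  have hYi := hY i (by simp)
  by_cases heven : 2 ∣ X i
  · obtain ⟨k, hk⟩ := heven
    have := hw _ (mem_rootsB_iff.2 (Or.inr ⟨i, 1, Or.inl rfl, rfl⟩))
      ⟨k, by rw [smul_χ_apply, halfVec, hk]; push_cast; ring,
        by rw [smul_χ_apply, halfVec, hYi, hk]; push_cast; ring⟩
    rw [smul_χ_apply] at this
    simpa using this
  · obtain ⟨j, hij, hd⟩ : ∃ j, i ≠ j ∧ 2 ∣ X i - X j := by
      by_contra! hno
      refine single_one_ne_zero i (hX _ fun f hf hk => ?_)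
      rcases mem_rootsB_iff.1 hf with hf | ⟨j, s, hs, rfl⟩
      · exact rootsD_single_eq_zero hno hf hk
      · obtain ⟨k, hk⟩ := hk
        rw [smul_χ_apply, halfVec] at hk
        have hk' : s * X j = 2 * k := by
          rify
          linarith
        have hij : j ≠ i := by
          rintro rfl
          rcases hs with rfl | rfl <;> omega
        rw [smul_χ_apply, Pi.single_eq_of_ne hij, mul_zero]
    exact apply_eq_zero_of_congruent (fun f hf => Or.inl hf) hij hd hYi (hY j hd) hw

end Coordinates

/-! ### Type A on the sum-zero hyperplane -/

section SumZero

variable {n : ℕ}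

theorem mem_sumZero {v : Fin (n + 1) → ℝ} : v ∈ sumZero n ↔ ∑ i, v i = 0 := by
  simp [sumZero, χ, LinearMap.mem_ker]

/-- The orthogonal projection of a vector to the sum-zero hyperplane. -/
noncomputable def toSumZero (v : Fin (n + 1) → ℝ) : sumZero n :=
  ⟨fun i => v i - (∑ j, v j) / (n + 1), by
    rw [mem_sumZero, Finset.sum_sub_distrib, Finset.sum_const, Finset.card_univ, Fintype.card_fin]
    have : (n : ℝ) + 1 ≠ 0 := by positivity
    simp only [nsmul_eq_mul]
    push_cast
    field_simp
    ring⟩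

theorem toSumZero_sub (v : Fin (n + 1) → ℝ) (i j : Fin (n + 1)) :
    (toSumZero v : Fin (n + 1) → ℝ) i - (toSumZero v : Fin (n + 1) → ℝ) j = v i - v j := by
  simp [toSumZero]

theorem sumZero_eq_zero {w : sumZero n} {i : Fin (n + 1)}
    (h : ∀ j, (w : Fin (n + 1) → ℝ) j = (w : Fin (n + 1) → ℝ) i) : w = 0 := by
  have hs := mem_sumZero.1 w.2
  rw [Finset.sum_congr rfl fun j _ => h j, Finset.sum_const, Finset.card_univ, Fintype.card_fin,
    smul_eq_zero] at hs
  ext j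
  rw [h j, hs.resolve_left (by simp)]
  rfl

theorem χ_sub_χ_apply (i j : Fin (n + 1)) (w : sumZero n) :
    ((χ i - χ j) ∘ₗ (sumZero n).subtype) w =
      (w : Fin (n + 1) → ℝ) i - (w : Fin (n + 1) → ℝ) j := rfl

/-- Roots integral at `x` kill the projected indicator of the coordinates congruent to `x 0` modulo
1; it vanishes only if that class is everything. -/
theorem isIsolated_rootsA_iff {x : sumZero n} : IsIsolated (rootsA n) x ↔
    ∀ i j, ∃ k : ℤ, (x : Fin (n + 1) → ℝ) i - (x : Fin (n + 1) → ℝ) j = k := by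
  classical
  constructor
  · intro h
    set v : Fin (n + 1) → ℝ := fun i =>
      if ∃ k : ℤ, (x : Fin (n + 1) → ℝ) i - (x : Fin (n + 1) → ℝ) 0 = k then 1 else 0 with hv
    have h0 := h (toSumZero v) (by
      rintro _ ⟨i, j, -, rfl⟩ ⟨k, hk⟩
      rw [χ_sub_χ_apply] at hk
      rw [χ_sub_χ_apply, toSumZero_sub, sub_eq_zero]
      have : (∃ l : ℤ, (x : Fin (n + 1) → ℝ) i - (x : Fin (n + 1) → ℝ) 0 = l) ↔
          ∃ l : ℤ, (x : Fin (n + 1) → ℝ) j - (x : Fin (n + 1) → ℝ) 0 = l :=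
        ⟨fun ⟨m, hm⟩ => ⟨m - k, by push_cast; linarith⟩,
          fun ⟨m, hm⟩ => ⟨m + k, by push_cast; linarith⟩⟩
      simp only [hv, this])
    have hint : ∀ i, ∃ k : ℤ, (x : Fin (n + 1) → ℝ) i - (x : Fin (n + 1) → ℝ) 0 = k := by
      intro i
      by_contra hi
      have h1 := toSumZero_sub v i 0
      rw [h0] at h1
      simp only [hv] at h1
      rw [if_neg hi, if_pos ⟨0, by simp⟩] at h1
      norm_num at h1
    intro i j
    obtain ⟨k, hk⟩ := hint i
    obtain ⟨l, hl⟩ := hint j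
    exact ⟨k - l, by push_cast; linarith⟩
  · intro h w hw
    refine sumZero_eq_zero (i := 0) fun j => ?_
    by_cases hj : j = 0
    · rw [hj]
    · have := hw _ ⟨j, 0, hj, rfl⟩ (h j 0)
      rw [χ_sub_χ_apply] at this
      linarith

theorem hasDescent_rootsA (n : ℕ) : HasDescent (rootsA n) := by
  classical
  intro r x hx hr
  have hint := isIsolated_rootsA_iff.1 hx
  obtain ⟨i₀, hi₀⟩ := Finite.exists_min (x : Fin (n + 1) → ℝ)
  -- This leaves a non-constant `x`, so that some coordinate really moves.
  by_cases hsmall : ∀ f ∈ rootsA n, f x ≤ r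
  · exact ⟨x, hx, Or.inl rfl, hsmall⟩
  set v : Fin (n + 1) → ℝ := fun i =>
    if (x : Fin (n + 1) → ℝ) i = (x : Fin (n + 1) → ℝ) i₀ then 0 else 1 with hv
  set y : sumZero n := x - toSumZero v with hy
  have hyval : ∀ i j, (y : Fin (n + 1) → ℝ) i - (y : Fin (n + 1) → ℝ) j =
      ((x : Fin (n + 1) → ℝ) i - (x : Fin (n + 1) → ℝ) j) - (v i - v j) := by
    intro i j
    rw [← toSumZero_sub v i j]
    simp only [hy, Submodule.coe_sub, Pi.sub_apply]
    ring
  have hv01 : ∀ i, v i = 0 ∨ v i = 1 := fun i => by simp only [hv]; split_ifs <;> simp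
  have hv0 : v i₀ = 0 := if_pos rfl
  -- The coordinates exceed the minimum by nonnegative integers, which are positive where `v = 1`.
  have hgap : ∀ i, v i = 1 → (x : Fin (n + 1) → ℝ) i₀ + 1 ≤ (x : Fin (n + 1) → ℝ) i := by
    intro i hi
    have hne : (x : Fin (n + 1) → ℝ) i ≠ (x : Fin (n + 1) → ℝ) i₀ := by
      intro h
      simp [hv, h] at hi
    obtain ⟨k, hk⟩ := hint i i₀
    have h1 : (0 : ℝ) < k := by
      rw [← hk, sub_pos]
      exact lt_of_le_of_ne (hi₀ i) hne.symm
    have h2 : (1 : ℝ) ≤ k := by exact_mod_cast h1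
    linarith
  have hmin : ∀ i, v i = 0 → (x : Fin (n + 1) → ℝ) i = (x : Fin (n + 1) → ℝ) i₀ := by
    intro i hi
    by_contra h
    simp [hv, h] at hi
  obtain ⟨i₁, hi₁⟩ : ∃ i, v i = 1 := by
    by_contra! hall
    refine hsmall ?_
    rintro _ ⟨i, j, -, rfl⟩
    rw [χ_sub_χ_apply, hmin i ((hv01 i).resolve_right (hall i)),
      hmin j ((hv01 j).resolve_right (hall j)), sub_self]
    positivity
  refine ⟨y, isIsolated_rootsA_iff.2 fun i j => ?_, Or.inr ⟨?_, ?_, ?_⟩, ?_⟩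
  · obtain ⟨k, hk⟩ := hint i j
    rw [hyval, hk]
    rcases hv01 i with h | h <;> rcases hv01 j with h' | h' <;> rw [h, h']
    exacts [⟨k, by simp⟩, ⟨k + 1, by simp⟩, ⟨k - 1, by simp⟩, ⟨k, by simp⟩]
  · intro hxy
    have := hyval i₁ i₀
    rw [← hxy, hi₁, hv0] at this
    linarith
  · rintro _ ⟨i, j, -, rfl⟩
    rw [χ_sub_χ_apply, χ_sub_χ_apply, hyval]
    obtain ⟨k, hk⟩ := hint i j
    rw [hk]
    rcases hv01 i with h | h <;> rcases hv01 j with h' | h' <;> rw [h, h']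
    exacts [⟨k, by simp⟩, ⟨k, by simp⟩, ⟨k - 1, by simp⟩, ⟨k, by simp⟩]
  · intro w hw
    have heq : ∀ i j, v i = v j → (w : Fin (n + 1) → ℝ) i = (w : Fin (n + 1) → ℝ) j := by
      intro i j hij
      by_cases hne : i = j
      · rw [hne]
      · obtain ⟨k, hk⟩ := hint i j
        have := hw _ ⟨i, j, hne, rfl⟩ ⟨k, by rw [χ_sub_χ_apply, hk],
          by rw [χ_sub_χ_apply, hyval, hk, hij, sub_self, sub_zero]⟩
        rw [χ_sub_χ_apply] at this
        linarith
    -- By `heq`, `w` is constant on the moved and on the unmoved coordinates; with sum zero, the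
    -- jump `c` determines it.
    set c := (w : Fin (n + 1) → ℝ) i₁ - (w : Fin (n + 1) → ℝ) i₀ with hc
    refine ⟨-c, ?_⟩
    rw [← sub_eq_zero]
    refine sumZero_eq_zero (i := i₀) fun j => ?_
    have h1 := hyval j i₀
    simp only [Submodule.coe_sub, Submodule.coe_smul, Pi.sub_apply, Pi.smul_apply, smul_eq_mul]
    rw [hv0] at h1
    rcases hv01 j with h | h
    · rw [h] at h1
      have h2 := heq j i₀ (h.trans hv0.symm)
      linear_combination h2 + c * h1
    · rw [h] at h1
      have h2 := heq j i₁ (h.trans hi₁.symm)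
      linear_combination h2 + c * h1 + hc
  · rintro _ ⟨i, j, hij, rfl⟩
    rw [χ_sub_χ_apply, hyval]
    have h1 := hr _ ⟨i, j, hij, rfl⟩
    rw [χ_sub_χ_apply] at h1
    rcases hv01 i with h | h <;> rcases hv01 j with h' | h' <;> rw [h, h']
    · rw [hmin i h, hmin j h']
      simp
    · have := hgap j h'
      rw [hmin i h]
      have : (0 : ℝ) ≤ r := by positivity
      linarith
    · linarith
    · have h3 := hgap j h'
      have h4 := hr _ ⟨i, i₀, by rintro rfl; rw [hv0] at h; norm_num at h, rfl⟩
      rw [χ_sub_χ_apply] at h4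
      linarith

end SumZero

theorem hasDescent_of_isClassical {ι M V : Type*} [AddCommGroup M] [Module ℝ M] [AddCommGroup V]
    [Module ℝ V] {P : RootPairing ι ℝ M V} (h : IsClassical P) :
    HasDescent (Set.range P.root') := by
  rcases h with ⟨n, -, e, he⟩ | ⟨n, hn, e, he⟩ | ⟨n, -, e, he⟩ | ⟨n, hn, e, he⟩ <;> rw [he]
  · exact (hasDescent_rootsA n).image e
  · exact (hasDescent_rootsB hn).image e
  · exact (hasDescent_rootsC n).image e
  · exact (hasDescent_rootsD (by omega)).image e

end SplitApartment

theorem theorem1p2 {ι M V E : Type*} [Finite ι] [AddCommGroup M] [Module ℝ M]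
    [NormedAddCommGroup V] [InnerProductSpace ℝ V] [MetricSpace E] [NormedAddTorsor V E]
    (P : RootPairing ι ℝ M V) [P.IsRootSystem] [P.IsCrystallographic] [P.IsReduced]
    [P.IsIrreducible] (horth : SplitApartment.ReflectionsOrthogonal P)
    (hclass : SplitApartment.IsClassical P)
    (p : E) (o : SplitApartment.Vertex P p) (ho : SplitApartment.IsSpecial P p (o : E))
    (b : P.Base) (i₀ : ι) (hi₀ : SplitApartment.IsHighestRoot b i₀)
    (x : SplitApartment.Vertex P p) (hx : (x : E) ∈ SplitApartment.closedCone b (o : E))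
    (r : ℕ) :
    SplitApartment.simplicialDist P p x o ≤ (r : ℕ∞) ↔
      P.root' i₀ ((x : E) -ᵥ (o : E)) ≤ (r : ℝ) := by
  constructor
  · intro h
    simpa using SplitApartment.root'_le_of_simplicialDist_le ho h i₀
  · intro h
    refine SplitApartment.simplicialDist_le_of_forall_root'_le ho
      (SplitApartment.hasDescent_of_isClassical hclass) r x fun i => ?_
    exact (SplitApartment.root'_le_of_isHighestRoot hi₀
      (fun j hj => SplitApartment.root'_nonneg_of_mem_closedCone hx hj) i).trans h
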